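/- Notation. $T^m=U(1)^m$ with $U(1)=\{z\in\mathbb C: |z|=1\}$. For a compact Hausdorff space $L$, $\mathring c(L)=L\times[0,1)/(L\times\{0\})$ is the open cone, with $\mathring c(\emptyset)$ a point (the vertex). Integers $l\ge 0$ and $0\le n\le m$ are given. Filtrations are by closed subsets. Let $X$ be a second-countable compact Hausdorff space with a continuous $T^m$-action all of whose isotropy groups $T_x$ are subtori (closed connected subgroups). For integers $i$, put $$X_{l+2i+(m-n)}=X_{l+2i+1+(m-n)}=\{x\in X:\dim T(x)\le i+(m-n)\},$$ where $T(x)$ is the orbit of $x$; this is the filtration $\mathfrak X$ by orbit dimension. Assume that $\mathfrak X$ makes $X$ a manifold stratified space, i.e. $X=X_{l+m+n}\supsetneq X_{l+m+n-1}$, $X_{l+(m-n)}\ne\emptyset=X_{l-1+(m-n)}$, and each $X_j\setminus X_{j-1}$ is a $j$-dimensional topological manifold (possibly empty). (Thus there are no orbits of dimension less than $m-n$, and there are free orbits.) By recursion on $l+n$, such an $(X,\mathfrak X)$ is an $(l+m+n)$-dimensional *locally standard $T$-pseudomanifold* if: - for $l=n=0$: $X$ is equivariantly homeomorphic to a finite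 disjoint union of copies of $T^m$ with the multiplication action; - for $l+n\ne 0$: $X_{l+m+n}\setminus X_{l+m+n-2}$ is dense in $X$, and for $0\le i\le n$ each $x$ with $\dim T(x)=i+(m-n)$ has a $T^m$-invariant open neighbourhood $U_x$ and a weakly equivariant homeomorphism $$U_x\to O\times(\Omega\times U(1)^{m-n})\times\mathring c(L_x),$$ where $O\subset\mathbb R^l$ is open and contractible, $\Omega\subset(\mathbb C\setminus\{0\})^i$ is open and $U(1)^i$-invariant, and $L_x$ is either empty or a compact locally standard $T^{n-i}$-pseudomanifold of dimension $2n-2i-1$ (with parameters $l',n'\ge0$, $l'+n'=n-i-1$). Here $T^m$ acts on the target through an isomorphism $T^m\cong T^m/T_x\times T_x\cong U(1)^{i+(m-n)}\times T^{n-i}$, the first factor acting on $\Omega\times U(1)^{m-n}$ by multiplication and the second on $\mathring c(L_x)$ through its action on $L_x$. A Hausdorff space $Q$ with a filtration $Q=Q_{l+n}\supset Q_{l+n-1}\supset\dots\supset Q_l\supset Q_{l-1}=\emptyset$ is an *$(l+n)$-dimensional topological stratified pseudomanifold* if $Q$ is discrete when $l+n=0$, and, when $l+n\neq0$, recursively: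 $Q_{l+n-1}\ne Q$, $Q_l\ne\emptyset$, and 1. each connected component of $Q_{l+i}\setminus Q_{l+i-1}$ ($0\le i\le n$) is an $(l+i)$-dimensional topological manifold; 2. $Q_{l+n}\setminus Q_{l+n-1}$ is dense in $Q$; 3. each $p\in Q_{l+i}\setminus Q_{l+i-1}$ has an open neighbourhood $U_p$, a compact filtered space $L_p$ that is empty or an $(n-i-1)$-dimensional topological stratified pseudomanifold, and a homeomorphism $U_p\to O_p\times\mathring c(L_p)$, with $O_p\subset\mathbb R^{l+i}$ open and contractible, that maps $U_p\cap Q_{l+i+j+1}$ onto $O_p\times\mathring c((L_p)_j)$ for $-1\le j\le n-i-1$. **Proposition.** Let $(X,\mathfrak X)$ be an $(l+m+n)$-dimensional locally standard $T$-pseudomanifold, and let $Q=X/T^m$ be the orbit space, filtered by $Q_{l+i}=X_{l+2i+(m-n)}/T^m$ for $0\le i\le n$. Then $Q$ is compact, Hausdorff and second countable, and with this filtration it is an $(l+n)$-dimensional topological stratified pseudomanifold. -/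

import Mathlib

universe u

noncomputable section

namespace TPseudo

/-- The compact torus `T^m = U(1)^m`. -/
abbrev Torus (m : ℕ) : Type := Fin m → Circle

/-- `A`, with the subspace topology, is a `d`-dimensional topological manifold (possibly empty):
Hausdorff, second countable and locally homeomorphic to `ℝ^d`. -/
def IsTopManifold {X : Type u} [TopologicalSpace X] (d : ℕ) (A : Set X) : Prop :=
  T2Space A ∧ SecondCountableTopology A ∧ Nonempty (ChartedSpace (EuclideanSpace ℝ (Fin d)) A)

/-! ### Filtrations -/

/-- An increasing filtration of `X` by closed subsets `F j`, with `F j = ∅` for `j < lo` and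
`F j = X` for `j ≥ hi`. Only the indices `lo, …, hi` carry information. -/
structure IsFiltration {X : Type u} [TopologicalSpace X] (lo hi : ℤ) (F : ℤ → Set X) : Prop where
  mono : Monotone F
  closed : ∀ j, IsClosed (F j)
  top : F hi = Set.univ
  bot : F (lo - 1) = ∅

/-- A manifold stratified space
`X = F hi ⊋ F (hi - 1) ⊇ ⋯ ⊇ F lo ⊋ F (lo - 1) = ∅`
such that each `F j \ F (j - 1)` is a `j`-dimensional topological manifold, possibly empty. -/
structure IsManifoldStratified {X : Type u} [TopologicalSpace X] (lo hi : ℕ) (F : ℤ → Set X) :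
    Prop where
  filtration : IsFiltration lo hi F
  top_strict : F ((hi : ℤ) - 1) ≠ Set.univ
  low_nonempty : (F (lo : ℤ)).Nonempty
  manifold : ∀ j : ℕ, lo ≤ j → j ≤ hi → IsTopManifold j (F (j : ℤ) \ F ((j : ℤ) - 1))

/-! ### Open cones -/

/-- The relation on `Y` that collapses the subset `A` to a point. -/
def collapseSetoid {Y : Type u} (A : Set Y) : Setoid Y where
  r a b := a = b ∨ (a ∈ A ∧ b ∈ A)
  iseqv :=
    { refl := fun _ => Or.inl rfl
      symm := by
        rintro a b (h | ⟨h, h'⟩)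
        · exact Or.inl h.symm
        · exact Or.inr ⟨h', h⟩
      trans := by
        rintro a b c (rfl | ⟨h, h'⟩) hbc
        · exact hbc
        · rcases hbc with rfl | ⟨_, h''⟩
          · exact Or.inr ⟨h, h'⟩
          · exact Or.inr ⟨h, h''⟩ }

/-- `L × [0, 1)` together with one extra isolated point. -/
abbrev PreCone (L : Type u) : Type u := (L × Set.Ico (0 : ℝ) 1) ⊕ PUnit.{u + 1}

/-- The points that become the cone vertex: `L × {0}` and the extra point. -/
def preApex (L : Type u) : Set (PreCone L) :=
  {a | ∀ q, a = Sum.inl q → (q.2 : ℝ) = 0}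

/-- The open cone `L × [0, 1) / L × {0}`, a single point when `L` is empty. The extra isolated
point is identified with `L × {0}`: for nonempty `L` it changes nothing, and for `L = ∅` it
provides the vertex. -/
def Cone (L : Type u) : Type u := Quotient (collapseSetoid (preApex L))

instance (L : Type u) [TopologicalSpace L] : TopologicalSpace (Cone L) :=
  inferInstanceAs (TopologicalSpace (Quotient (collapseSetoid (preApex L))))

/-- The cone vertex. -/
def Cone.apex (L : Type u) : Cone L :=
  Quotient.mk (collapseSetoid (preApex L)) (Sum.inr PUnit.unit)

/-- The point `[v, s]` of the open cone. -/
def Cone.mk {L : Type u} (v : L) (s : Set.Ico (0 : ℝ) 1) : Cone L :=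
  Quotient.mk (collapseSetoid (preApex L)) (Sum.inl (v, s))

/-- The map of open cones `[v, s] ↦ [f v, s]` induced by `f`; it preserves the vertex. -/
def Cone.map {L L' : Type u} (f : L → L') : Cone L → Cone L' :=
  Quotient.map' (s₁ := collapseSetoid (preApex L)) (s₂ := collapseSetoid (preApex L'))
    (Sum.map (fun q => (f q.1, q.2)) id) (by
      rintro a b (rfl | ⟨ha, hb⟩)
      · exact Or.inl rfl
      · refine Or.inr ⟨?_, ?_⟩
        · intro q hq
          rcases a with a | a
          · have h := ha a rfl
            simp only [Sum.map_inl, Sum.inl.injEq] at hq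
            rw [← hq]
            exact h
          · simp at hq
        · intro q hq
          rcases b with b | b
          · have h := hb b rfl
            simp only [Sum.map_inl, Sum.inl.injEq] at hq
            rw [← hq]
            exact h
          · simp at hq)

/-- The open cone on a subset `A ⊆ L`, as a subset of the open cone on `L`; for `A = ∅` it is the
cone vertex alone. -/
def subcone {L : Type u} (A : Set L) : Set (Cone L) :=
  {c | c = Cone.apex L ∨ ∃ v ∈ A, ∃ s, c = Cone.mk v s}

/-! ### Topological stratified pseudomanifolds -/

/-- A distinguished chart at `p`: a homeomorphism of an open neighbourhood `U` of `p` onto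
`O × c(L)`, with `O` a contractible open subset of `ℝ^k` and `c(L)` the open cone on the filtered
space `(L, G)`, taking `U ∩ F (k + j + 1)` onto `O × c(G j)` for `-1 ≤ j ≤ r`. -/
structure ConeChart {Q : Type u} [TopologicalSpace Q] (F : ℤ → Set Q) (k : ℕ) (r : ℤ) (p : Q)
    (L : Type u) [TopologicalSpace L] (G : ℤ → Set L) where
  U : Set Q
  isOpen_U : IsOpen U
  mem_U : p ∈ U
  O : Set (EuclideanSpace ℝ (Fin k))
  isOpen_O : IsOpen O
  contractible_O : ContractibleSpace O
  φ : U ≃ₜ O × Cone L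
  map_filtration : ∀ j : ℤ, -1 ≤ j → j ≤ r →
    ∀ u : U, (u : Q) ∈ F ((k : ℤ) + j + 1) ↔ (φ u).2 ∈ subcone (G j)

/-- `(Q, F)` is an `(l + n)`-dimensional topological stratified pseudomanifold
`Q = F (l + n) ⊋ F (l + n - 1) ⊇ ⋯ ⊇ F l ⊋ F (l - 1) = ∅`, by recursion on the dimension.
The link of a point of the `(l + i)`-dimensional stratum is a compact topological stratified
pseudomanifold of dimension `n - i - 1`, or empty. -/
def IsStratifiedPseudomanifold (l n : ℕ) (Q : Type u) [TopologicalSpace Q] (F : ℤ → Set Q) :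
    Prop :=
  T2Space Q ∧ IsFiltration (l : ℤ) ((l : ℤ) + n) F ∧
  (l + n = 0 → DiscreteTopology Q) ∧
  (l + n ≠ 0 →
    F ((l : ℤ) + n - 1) ≠ Set.univ ∧ (F (l : ℤ)).Nonempty ∧
    (∀ i : ℕ, i ≤ n → ∀ x ∈ F ((l : ℤ) + i) \ F ((l : ℤ) + i - 1),
      IsTopManifold (l + i) (connectedComponentIn (F ((l : ℤ) + i) \ F ((l : ℤ) + i - 1)) x)) ∧
    Dense (F ((l : ℤ) + n) \ F ((l : ℤ) + n - 1)) ∧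
    (∀ i : ℕ, i ≤ n → ∀ p ∈ F ((l : ℤ) + i) \ F ((l : ℤ) + i - 1),
      ∃ (L : Type u) (_ : TopologicalSpace L) (G : ℤ → Set L),
        CompactSpace L ∧
        (IsEmpty L ∨ ∃ (l' n' : ℕ) (_ : l' + n' + i + 1 = n),
          IsStratifiedPseudomanifold l' n' L G) ∧
        Nonempty (ConeChart F (l + i) ((n : ℤ) - i - 1) p L G)))
termination_by l + n

/-! ### Torus actions and the filtration by orbit dimension -/

/-- The dimension of a closed subgroup `H` of a torus: the largest `k` such that `H` contains a
`k`-dimensional torus (the identity component of `H` is such a torus). -/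
def subgroupDim {m : ℕ} (H : Subgroup (Torus m)) : ℕ :=
  sSup {k : ℕ | ∃ f : Torus k →ₜ* H, Function.Injective f}

/-- The dimension of the orbit `T(x) ≅ T^m / T_x`. -/
def orbitDim (m : ℕ) {X : Type u} [MulAction (Torus m) X] (x : X) : ℕ :=
  m - subgroupDim (MulAction.stabilizer (Torus m) x)

/-- The filtration by orbit dimension:
`X_{l+2i+(m-n)} = X_{l+2i+1+(m-n)} = {x | dim T(x) ≤ i + (m - n)}`. -/
def orbitDimFiltration (l m n : ℕ) (X : Type u) [MulAction (Torus m) X] (j : ℤ) : Set X :=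
  {x | (orbitDim m x : ℤ) ≤ (j - (l + (m - n))) / 2 + (m - n)}

/-- The orbit space `X / T^m` with the quotient topology. -/
abbrev OrbitSpace (m : ℕ) (X : Type u) [MulAction (Torus m) X] : Type u :=
  MulAction.orbitRel.Quotient (Torus m) X

/-- The filtration of the orbit space, `Q_{l+i} = X_{l+2i+(m-n)} / T`. -/
def orbitSpaceFiltration (l m n : ℕ) (X : Type u) [MulAction (Torus m) X] (k : ℤ) :
    Set (OrbitSpace m X) :=
  (Quotient.mk (MulAction.orbitRel (Torus m) X)) ''
    orbitDimFiltration l m n X (l + 2 * (k - l) + (m - n))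

/-! ### Locally standard torus pseudomanifolds -/

/-- A standard chart at `x`, a point whose orbit has dimension `i + (m - n)`: a weakly equivariant
homeomorphism of an invariant open neighbourhood `U` of `x` onto `O × (Ω × U(1)^(m-n)) × c(L)`.
The torus `T^m` acts on the target through an isomorphism
`ψ : T^m ≅ (U(1)^i × U(1)^(m-n)) × T^(n-i)` that identifies the isotropy group `T_x` with the last
factor; the first two factors act by multiplication on `Ω × U(1)^(m-n)`, and the last factor acts
on the `L`-coordinate of `c(L)`. -/
structure StandardChart (l m n i : ℕ) {X : Type u} [TopologicalSpace X] [MulAction (Torus m) X]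
    (x : X) (L : Type u) [TopologicalSpace L] [MulAction (Torus (n - i)) L] where
  U : Set X
  isOpen_U : IsOpen U
  mem_U : x ∈ U
  smul_mem_U : ∀ (t : Torus m) (y : X), y ∈ U → t • y ∈ U
  O : Set (EuclideanSpace ℝ (Fin l))
  isOpen_O : IsOpen O
  contractible_O : ContractibleSpace O
  Ω : Set (Fin i → ℂ)
  isOpen_Ω : IsOpen Ω
  ne_zero_of_mem_Ω : ∀ w ∈ Ω, ∀ a, w a ≠ 0
  mul_mem_Ω : ∀ (t : Torus i) (w : Fin i → ℂ), w ∈ Ω → (fun a => (t a : ℂ) * w a) ∈ Ω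
  ψ : Torus m ≃ₜ* (Torus i × Torus (m - n)) × Torus (n - i)
  mem_stabilizer_iff : ∀ t : Torus m, t ∈ MulAction.stabilizer (Torus m) x ↔ (ψ t).1 = 1
  φ : U ≃ₜ O × (Ω × Torus (m - n)) × Cone L
  equivariant : ∀ (t : Torus m) (y : U),
    φ ⟨t • (y : X), smul_mem_U t y y.2⟩ =
      ((φ y).1,
        (⟨fun a => ((ψ t).1.1 a : ℂ) * ((φ y).2.1.1 : Fin i → ℂ) a,
            mul_mem_Ω (ψ t).1.1 _ (φ y).2.1.1.2⟩,
          (ψ t).1.2 * (φ y).2.1.2),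
        Cone.map (fun v => (ψ t).2 • v) (φ y).2.2)

/-- The standing assumptions on a `T^m`-space `X` with parameters `l` and `n`. -/
structure IsAdmissible (l m n : ℕ) (X : Type u) [TopologicalSpace X] [MulAction (Torus m) X] :
    Prop where
  compact : CompactSpace X
  t2 : T2Space X
  secondCountable : SecondCountableTopology X
  continuous_smul : ContinuousSMul (Torus m) X
  le : n ≤ m
  /-- every isotropy group is a subtorus, i.e. a closed connected subgroup -/
  isotropy : ∀ x : X, IsClosed (MulAction.stabilizer (Torus m) x : Set (Torus m)) ∧
    IsConnected (MulAction.stabilizer (Torus m) x : Set (Torus m))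
  stratified : IsManifoldStratified (l + (m - n)) (l + m + n) (orbitDimFiltration l m n X)
  /-- there are no orbits of dimension less than `m - n` -/
  no_small_orbits : {x : X | (orbitDim m x : ℤ) ≤ (m - n) - 1} = ∅
  /-- there are free orbits -/
  free_orbits : l + n ≠ 0 → orbitDimFiltration l m n X ((l : ℤ) + m + n - 2) ≠ Set.univ

/-- `X`, with its `T^m`-action and the filtration by orbit dimension, is an
`(l + m + n)`-dimensional locally standard `T`-pseudomanifold, by recursion on `l + n`.
The link `L` of a point `x` with orbit dimension `i + (m - n)` is a locally standard
`T^(n-i)`-pseudomanifold of dimension `l' + (n - i) + n' = 2n - 2i - 1`, or empty. -/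
def IsLocallyStandardTPseudomanifold (l m n : ℕ) (X : Type u) [TopologicalSpace X]
    [MulAction (Torus m) X] : Prop :=
  IsAdmissible l m n X ∧
  (l + n = 0 → ∃ (k : ℕ) (e : X ≃ₜ Fin k × Torus m),
    ∀ (t : Torus m) (x : X), e (t • x) = ((e x).1, t * (e x).2)) ∧
  (l + n ≠ 0 →
    Dense (orbitDimFiltration l m n X ((l : ℤ) + m + n) \
      orbitDimFiltration l m n X ((l : ℤ) + m + n - 2)) ∧
    (∀ i : ℕ, i ≤ n →
      ∀ x ∈ orbitDimFiltration l m n X ((l : ℤ) + 2 * i + (m - n)) \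
        orbitDimFiltration l m n X ((l : ℤ) + 2 * ((i : ℤ) - 1) + (m - n)),
      ∃ (L : Type u) (_ : TopologicalSpace L) (_ : MulAction (Torus (n - i)) L),
        (IsEmpty L ∨ ∃ (l' n' : ℕ) (_ : l' + n' + i + 1 = n),
          IsLocallyStandardTPseudomanifold l' (n - i) n' L) ∧
        Nonempty (StandardChart l m n i x L)))
termination_by l + n

end TPseudo

end

noncomputable section
namespace TPseudo

open Topology

/-! ### Dimensions of subgroups of tori -/

/-! The statement is local on `X`. In a standard chart `O × (Ω × U(1)^(m-n)) × c(L)` the factor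
`U(1)^i × U(1)^(m-n)` of the torus acts freely by multiplication. An orbit is therefore determined
by its point of `O`, the moduli of its coordinates in `Ω`, and its class in `c(L)/T^(n-i) =
c(L/T^(n-i))`. `StandardChart.orbitMap` records these data; it is continuous and open, and its
fibres are orbits, so `Q` is locally an open piece of `ℝ^(l+i) × c(L/T^(n-i))`.

Under `ψ`, stabilizers become `1 × T^(n-i)` at the vertex and `1 × T_v` at `[v, s]` with `s ≠ 0`.
The orbit dimension is thus `i + (m-n)`, increased off the vertex by the dimension of the orbit of
`v`. Hence the filtration of `Q` is the cone filtration (`StandardChart.exists_coneChart`), and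
induction on `l + n` applies to `L/T^(n-i)`. The strata are manifolds because the lowest stratum in
a cone chart is `O × {vertex}`. -/

theorem le_of_injective_torus_hom {k m : ℕ} (f : Torus k →* Torus m)
    (hf : Function.Injective f) : k ≤ m := by
  -- Compare 2-torsion: `f` embeds a group of order `2^k` into one of order `2^m`.
  let S : Type := rootsOfUnity 2 Circle
  have hS : Nat.card S = 2 := HasEnoughRootsOfUnity.natCard_rootsOfUnity Circle 2
  have : Finite S := Nat.finite_of_card_ne_zero (by omega)
  have hsq : ∀ s : S, ((s : Circleˣ) : Circle) ^ 2 = 1 := fun s => by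
    have := (mem_rootsOfUnity 2 (s : Circleˣ)).1 s.2
    exact_mod_cast congrArg Units.val this
  let ι : (Fin k → S) → Torus k := fun r b => ((r b : Circleˣ) : Circle)
  have hι : Function.Injective ι := fun r r' h => funext fun b =>
    Subtype.ext (Units.ext (congrFun h b))
  have hpow : ∀ r a, f (ι r) a ^ 2 = 1 := fun r a => by
    have h1 : ι r ^ 2 = 1 := funext fun b => hsq (r b)
    have h2 : f (ι r) ^ 2 = 1 := by rw [← map_pow, h1, map_one]
    exact congrFun h2 a
  let g : (Fin k → S) → (Fin m → S) := fun r a => rootsOfUnity.mkOfPowEq (f (ι r) a) (hpow r a)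
  have hg : Function.Injective g := fun r r' h => hι <| hf <| funext fun a => by
    simpa [g] using congrArg (fun s : S => ((s : Circleˣ) : Circle)) (congrFun h a)
  have := Nat.card_le_card_of_injective g hg
  rw [Nat.card_fun, Nat.card_fun, hS, Nat.card_fin, Nat.card_fin] at this
  exact (Nat.pow_le_pow_iff_right (by norm_num)).1 this

/-- Boundedness keeps the `sSup` defining `subgroupDim` from taking its default value `0`. -/
theorem mem_upperBounds_subgroupDim {m : ℕ} (H : Subgroup (Torus m)) :
    m ∈ upperBounds {k : ℕ | ∃ f : Torus k →ₜ* H, Function.Injective f} := by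
  rintro k ⟨f, hf⟩
  exact le_of_injective_torus_hom (H.subtype.comp f.toMonoidHom)
    (H.subtype_injective.comp hf)

theorem subgroupDim_le {m : ℕ} (H : Subgroup (Torus m)) : subgroupDim H ≤ m :=
  csSup_le' (mem_upperBounds_subgroupDim H)

theorem subgroupDim_mono {m m' : ℕ} {H : Subgroup (Torus m)} {H' : Subgroup (Torus m')}
    (g : H →ₜ* H') (hg : Function.Injective g) : subgroupDim H ≤ subgroupDim H' :=
  csSup_le_csSup' ⟨m', mem_upperBounds_subgroupDim H'⟩
    (by rintro k ⟨f, hf⟩; exact ⟨g.comp f, hg.comp hf⟩)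

theorem subgroupDim_top {m : ℕ} : subgroupDim (⊤ : Subgroup (Torus m)) = m := by
  refine le_antisymm (subgroupDim_le _) (le_csSup ⟨m, mem_upperBounds_subgroupDim _⟩ ?_)
  exact ⟨⟨⟨⟨fun t => ⟨t, trivial⟩, rfl⟩, fun _ _ => rfl⟩, by fun_prop⟩,
    fun a b h => congrArg Subtype.val h⟩

/-- The hypothesis says `H = ψ⁻¹(1 × H')`, the shape of every stabilizer in a standard chart; `ψ`
then restricts to an isomorphism `H ≅ H'`. -/
theorem subgroupDim_eq_of_prod {m r : ℕ} {A : Type} [Group A] [TopologicalSpace A]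
    (ψ : Torus m ≃ₜ* A × Torus r) {H : Subgroup (Torus m)} {H' : Subgroup (Torus r)}
    (h : ∀ t, t ∈ H ↔ (ψ t).1 = 1 ∧ (ψ t).2 ∈ H') : subgroupDim H = subgroupDim H' := by
  apply le_antisymm
  · refine subgroupDim_mono
      ⟨⟨⟨fun t => ⟨(ψ t.1).2, ((h t.1).1 t.2).2⟩, by ext; simp⟩, fun a b => by ext; simp⟩, ?_⟩ ?_
    · exact Continuous.subtype_mk
        (continuous_snd.comp (ψ.continuous_toFun.comp continuous_subtype_val)) _
    · intro a b hab
      have hab : (ψ a.1).2 = (ψ b.1).2 := congrArg Subtype.val hab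
      have : ψ a.1 = ψ b.1 :=
        Prod.ext (((h a.1).1 a.2).1.trans ((h b.1).1 b.2).1.symm) hab
      exact Subtype.ext (ψ.injective this)
  · refine subgroupDim_mono
      ⟨⟨⟨fun s => ⟨ψ.symm (1, s.1), (h _).2 (by simp)⟩, ?_⟩, fun a b => ?_⟩, ?_⟩ ?_
    · exact Subtype.ext (map_one ψ.symm)
    · refine Subtype.ext ?_
      change ψ.symm (1, a.1 * b.1) = ψ.symm (1, a.1) * ψ.symm (1, b.1)
      rw [← map_mul]; simp
    · exact Continuous.subtype_mk (ψ.symm.continuous_toFun.comp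
        (by fun_prop : Continuous fun s : H' => ((1 : A), (s : Torus r)))) _
    · intro a b hab
      have hab := ψ.symm.injective (congrArg Subtype.val hab)
      exact Subtype.ext (congrArg Prod.snd hab)

theorem orbitDim_le (m : ℕ) {X : Type u} [MulAction (Torus m) X] (x : X) : orbitDim m x ≤ m :=
  Nat.sub_le _ _

theorem orbitDim_smul (m : ℕ) {X : Type u} [MulAction (Torus m) X] (t : Torus m) (x : X) :
    orbitDim m (t • x) = orbitDim m x := by
  -- The torus is commutative, so conjugate stabilizers coincide.
  have : MulAction.stabilizer (Torus m) (t • x) = MulAction.stabilizer (Torus m) x := by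
    ext s
    simp only [MulAction.mem_stabilizer_iff]
    rw [smul_comm, (MulAction.injective t).eq_iff]
  rw [orbitDim, orbitDim, this]

/-! ### Open cones -/

section Cone

variable {L L' : Type u}

theorem Cone.exists_rep (c : Cone L) :
    c = Cone.apex L ∨ ∃ (v : L) (s : Set.Ico (0 : ℝ) 1), (s : ℝ) ≠ 0 ∧ c = Cone.mk v s := by
  obtain ⟨a, rfl⟩ := Quotient.exists_rep c
  rcases a with ⟨v, s⟩ | a
  · by_cases hs : (s : ℝ) = 0
    · left
      refine Quotient.sound (Or.inr ⟨?_, fun q hq => by simp at hq⟩)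
      intro q hq
      rw [← Sum.inl.inj hq]; exact hs
    · exact Or.inr ⟨v, s, hs, rfl⟩
  · exact Or.inl rfl

theorem Cone.mk_ne_apex (v : L) {s : Set.Ico (0 : ℝ) 1} (hs : (s : ℝ) ≠ 0) :
    Cone.mk v s ≠ Cone.apex L := by
  intro h
  rcases Quotient.exact h with h | ⟨h, -⟩
  · simp at h
  · exact hs (h _ rfl)

theorem Cone.mk_inj {v v' : L} {s s' : Set.Ico (0 : ℝ) 1} (hs : (s : ℝ) ≠ 0)
    (h : Cone.mk v s = Cone.mk v' s') : v = v' ∧ s = s' := by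
  rcases Quotient.exact h with h | ⟨h, -⟩
  · simpa using h
  · exact absurd (h _ rfl) hs

theorem Cone.mk_mem_subcone {v : L} {s : Set.Ico (0 : ℝ) 1} (hs : (s : ℝ) ≠ 0) {A : Set L} :
    Cone.mk v s ∈ subcone A ↔ v ∈ A := by
  constructor
  · rintro (h | ⟨v', hv', s', h⟩)
    · exact absurd h (Cone.mk_ne_apex v hs)
    · rwa [(Cone.mk_inj hs h).1]
  · exact fun h => Or.inr ⟨v, h, s, rfl⟩

@[simp]
theorem Cone.map_apex (f : L → L') : Cone.map f (Cone.apex L) = Cone.apex L' := rfl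

@[simp]
theorem Cone.map_mk (f : L → L') (v : L) (s : Set.Ico (0 : ℝ) 1) :
    Cone.map f (Cone.mk v s) = Cone.mk (f v) s := rfl

theorem Cone.map_surjective {f : L → L'} (hf : Function.Surjective f) :
    Function.Surjective (Cone.map f) := by
  intro c
  rcases c.exists_rep with rfl | ⟨v, s, -, rfl⟩
  · exact ⟨Cone.apex L, rfl⟩
  · obtain ⟨w, rfl⟩ := hf v
    exact ⟨Cone.mk w s, rfl⟩

/-- Identifies `c(L)/T` with `c(L/T)` as sets: the action preserves the height `s` and fixes the
vertex. -/
theorem Cone.map_mk_eq_iff {m : ℕ} [MulAction (Torus m) L] (c c' : Cone L) :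
    Cone.map (Quotient.mk (MulAction.orbitRel (Torus m) L)) c =
      Cone.map (Quotient.mk (MulAction.orbitRel (Torus m) L)) c' ↔
    ∃ t : Torus m, Cone.map (fun v => t • v) c' = c := by
  constructor
  · intro h
    rcases c.exists_rep with rfl | ⟨v, s, hs, rfl⟩ <;>
    rcases c'.exists_rep with rfl | ⟨v', s', hs', rfl⟩
    · exact ⟨1, rfl⟩
    · exact absurd h.symm (Cone.mk_ne_apex _ hs')
    · exact absurd h (Cone.mk_ne_apex _ hs)
    · obtain ⟨h1, rfl⟩ := Cone.mk_inj hs h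
      obtain ⟨t, rfl⟩ : v ∈ MulAction.orbit (Torus m) v' := Quotient.exact h1
      exact ⟨t, rfl⟩
  · rintro ⟨t, rfl⟩
    rcases c'.exists_rep with rfl | ⟨v', s', hs', rfl⟩
    · rfl
    · simp only [Cone.map_mk]
      congr 1
      exact Quotient.sound ⟨t, rfl⟩

variable [TopologicalSpace L] [TopologicalSpace L']

theorem Cone.continuous_map {f : L → L'} (hf : Continuous f) : Continuous (Cone.map f) :=
  Continuous.quotient_map' (s := collapseSetoid (preApex L)) (t := collapseSetoid (preApex L'))
    (Continuous.sumMap (by fun_prop) continuous_id) _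

theorem Cone.isOpenMap_map {f : L → L'} (hf : IsOpenMap f) (hs : Function.Surjective f) :
    IsOpenMap (Cone.map f) := by
  intro V hV
  let p : PreCone L → Cone L := Quotient.mk (collapseSetoid (preApex L))
  let p' : PreCone L' → Cone L' := Quotient.mk (collapseSetoid (preApex L'))
  let g : PreCone L → PreCone L' := Sum.map (Prod.map f id) id
  have hg : IsOpenMap g := (hf.prodMap IsOpenMap.id).sumMap IsOpenMap.id
  have hgs : Function.Surjective g :=
    Function.Surjective.sumMap (hs.prodMap Function.surjective_id) Function.surjective_id
  have hgA : ∀ a, g a ∈ preApex L' → a ∈ preApex L := by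
    rintro (⟨v, s⟩ | a) h q hq
    · rw [← Sum.inl.inj hq]; exact h (f v, s) rfl
    · simp at hq
  -- Surjectivity matters at the vertex: if `V` contains it, the right-hand side must contain all of
  -- `preApex L'`, so each such point needs a preimage, which `hgA` places in `preApex L`.
  have key : p' ⁻¹' (Cone.map f '' V) = g '' (p ⁻¹' V) := by
    ext b
    constructor
    · rintro ⟨c, hc, hcb⟩
      obtain ⟨a, rfl⟩ := Quotient.exists_rep c
      rcases Quotient.exact (hcb : p' (g a) = p' b) with h | ⟨h, h'⟩
      · exact ⟨a, hc, h⟩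
      · obtain ⟨a', rfl⟩ := hgs b
        refine ⟨a', ?_, rfl⟩
        have : p a' = p a := Quotient.sound (Or.inr ⟨hgA _ h', hgA _ h⟩)
        change p a' ∈ V
        rw [this]; exact hc
    · rintro ⟨a, ha, rfl⟩
      exact ⟨p a, ha, rfl⟩
  have hV' : IsOpen (p ⁻¹' V) := hV.preimage continuous_quotient_mk'
  have := hg _ hV'
  rw [← key] at this
  exact this

end Cone

/-! ### The coordinatewise norm -/

/-- Rescaling the coordinates of `w` gives a continuous local section `σ` of the norm map through
`w`, so the norm map is open at `w`. -/
theorem nhds_norm_le {i : ℕ} (w : Fin i → ℂ) (hw : ∀ a, w a ≠ 0) :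
    𝓝 (fun a => ‖w a‖) ≤ Filter.map (fun (z : Fin i → ℂ) a => ‖z a‖) (𝓝 w) := by
  let σ : (Fin i → ℝ) → (Fin i → ℂ) := fun r a => ((r a / ‖w a‖ : ℝ) : ℂ) * w a
  have hσ : Continuous σ := by fun_prop
  have hσw : σ (fun a => ‖w a‖) = w := by
    funext a
    simp [σ, hw a]
  have hpos : ∀ᶠ r : Fin i → ℝ in 𝓝 (fun a => ‖w a‖), ∀ a, 0 < r a :=
    Filter.eventually_all.2 fun a =>
      (continuous_apply a).continuousAt.eventually (lt_mem_nhds (norm_pos_iff.2 (hw a)))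
  have hs : (fun r a => ‖σ r a‖) =ᶠ[𝓝 (fun a => ‖w a‖)] id := by
    filter_upwards [hpos] with r hr
    funext a
    simp [σ, hw a, abs_of_pos (hr a)]
  calc 𝓝 (fun a => ‖w a‖) = Filter.map (fun r a => ‖σ r a‖) (𝓝 (fun a => ‖w a‖)) := by
        rw [Filter.map_congr hs, Filter.map_id]
    _ = Filter.map (fun (z : Fin i → ℂ) a => ‖z a‖) (Filter.map σ (𝓝 (fun a => ‖w a‖))) := rfl
    _ ≤ _ := Filter.map_mono (by
          have := hσ.tendsto (fun a => ‖w a‖)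
          rwa [hσw] at this)

theorem isOpenMap_norm_restrict {i : ℕ} {Ω : Set (Fin i → ℂ)} (hΩ : IsOpen Ω)
    (h0 : ∀ w ∈ Ω, ∀ a, w a ≠ 0) :
    IsOpenMap (fun (w : Ω) (a : Fin i) => ‖w.1 a‖) := by
  rw [isOpenMap_iff_nhds_le]
  intro w
  have h : Filter.map (Subtype.val : Ω → Fin i → ℂ) (𝓝 w) = 𝓝 w.1 :=
    hΩ.isOpenEmbedding_subtypeVal.map_nhds_eq w
  have := nhds_norm_le w.1 (h0 w.1 w.2)
  rwa [← h, Filter.map_map] at this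

theorem exists_circle_mul_eq {w z : ℂ} (hz : z ≠ 0) (h : ‖w‖ = ‖z‖) :
    ∃ t : Circle, (t : ℂ) * z = w :=
  ⟨⟨w / z, mem_sphere_zero_iff_norm.2 (by rw [norm_div, h, div_self (norm_ne_zero_iff.2 hz)])⟩,
    div_mul_cancel₀ w hz⟩

/-! ### Quotients with the same fibres -/

theorem exists_homeomorph_of_fibers {V Y Z : Type*} [TopologicalSpace V] [TopologicalSpace Y]
    [TopologicalSpace Z] {f : V → Y} {g : V → Z} (hf : IsOpenQuotientMap f)
    (hg : IsOpenQuotientMap g) (h : ∀ a b, f a = f b ↔ g a = g b) :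
    ∃ e : Y ≃ₜ Z, ∀ a, e (f a) = g a := by
  let F : Y → Z := fun y => g (Function.surjInv hf.surjective y)
  have hF : ∀ a, F (f a) = g a := fun a => (h _ _).1 (Function.surjInv_eq hf.surjective (f a))
  let G : Z → Y := fun z => f (Function.surjInv hg.surjective z)
  have hG : ∀ a, G (g a) = f a := fun a => (h _ _).2 (Function.surjInv_eq hg.surjective (g a))
  refine ⟨⟨⟨F, G, fun y => ?_, fun z => ?_⟩, ?_, ?_⟩, hF⟩
  · obtain ⟨a, rfl⟩ := hf.surjective y
    rw [hF, hG]
  · obtain ⟨a, rfl⟩ := hg.surjective z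
    rw [hG, hF]
  · rw [hf.isQuotientMap.continuous_iff, show F ∘ f = g from funext hF]
    exact hg.continuous
  · rw [hg.isQuotientMap.continuous_iff, show G ∘ g = f from funext hG]
    exact hf.continuous

theorem exists_homeomorph_image {X Q Z : Type*} [TopologicalSpace X] [TopologicalSpace Q]
    [TopologicalSpace Z] {π : X → Q} (hπ : IsOpenQuotientMap π) {U : Set X} (hU : IsOpen U)
    {Ψ : U → Z} (hc : Continuous Ψ) (ho : IsOpenMap Ψ)
    (h : ∀ y y' : U, π y = π y' ↔ Ψ y = Ψ y') {W : Set Z} (hW : IsOpen W)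
    (hWr : W ⊆ Set.range Ψ) :
    ∃ U' : Set Q, IsOpen U' ∧ (∀ q, q ∈ U' ↔ ∃ y : U, Ψ y ∈ W ∧ π y = q) ∧
      ∃ e : U' ≃ₜ W, ∀ (y : U) (hy : π y ∈ U'), (e ⟨π y, hy⟩ : Z) = Ψ y := by
  have hπU : IsOpenMap (fun y : U => π y) := hπ.isOpenMap.comp hU.isOpenMap_subtype_val
  have hπc : Continuous (fun y : U => π y) := hπ.continuous.comp continuous_subtype_val
  let U' : Set Q := (fun y : U => π y) '' (Ψ ⁻¹' W)
  have hV : IsOpen (Ψ ⁻¹' W) := hW.preimage hc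
  let f : (Ψ ⁻¹' W) → U' := fun v => ⟨π v.1, v, v.2, rfl⟩
  let g : (Ψ ⁻¹' W) → W := fun v => ⟨Ψ v.1, v.2⟩
  have hf : IsOpenQuotientMap f := by
    refine ⟨?_, ?_, ?_⟩
    · rintro ⟨_, v, hv, rfl⟩
      exact ⟨⟨v, hv⟩, rfl⟩
    · exact (hπc.comp continuous_subtype_val).subtype_mk _
    · exact (hπU.comp hV.isOpenMap_subtype_val).subtype_mk _
  have hg : IsOpenQuotientMap g := by
    refine ⟨?_, ?_, ?_⟩
    · rintro ⟨z, hz⟩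
      obtain ⟨v, rfl⟩ := hWr hz
      exact ⟨⟨v, hz⟩, rfl⟩
    · exact (hc.comp continuous_subtype_val).subtype_mk _
    · exact (ho.comp hV.isOpenMap_subtype_val).subtype_mk _
  obtain ⟨e, he⟩ := exists_homeomorph_of_fibers hf hg
    (fun a b => by simpa [f, g, Subtype.ext_iff] using h a.1 b.1)
  refine ⟨U', hπU _ hV, fun q => Iff.rfl, e, ?_⟩
  -- The witness `v` of `π y ∈ U'` may differ from `y`; equality of fibres moves `y` itself into `Ψ
  -- ⁻¹' W`.
  rintro y ⟨v, hv, hvy⟩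
  have hy' : Ψ y = Ψ v := (h _ _).1 hvy.symm
  have hy : Ψ y ∈ W := by rw [hy']; exact hv
  exact congrArg Subtype.val (he ⟨y, hy⟩)

/-! ### Standard charts and orbits -/

section OrbitFiltration

variable {l m n : ℕ} {X : Type u} [MulAction (Torus m) X]

/-- At these indices the numerator is the even number `2 * (k - l)`, so the floor division is exact.
-/
theorem mem_orbitDimFiltration {k : ℤ} {x : X} :
    x ∈ orbitDimFiltration l m n X ((l : ℤ) + 2 * (k - l) + (m - n)) ↔
      (orbitDim m x : ℤ) ≤ (k - l) + (m - n) := by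
  rw [orbitDimFiltration, Set.mem_ofPred_eq]
  have : ((l : ℤ) + 2 * (k - l) + (m - n) - (l + (m - n))) / 2 = k - l := by omega
  rw [this]

theorem mk_mem_orbitSpaceFiltration {k : ℤ} {x : X} :
    Quotient.mk (MulAction.orbitRel (Torus m) X) x ∈ orbitSpaceFiltration l m n X k ↔
      (orbitDim m x : ℤ) ≤ (k - l) + (m - n) := by
  rw [← mem_orbitDimFiltration]
  constructor
  · rintro ⟨y, hy, hyx⟩
    obtain ⟨t, rfl⟩ : y ∈ MulAction.orbit (Torus m) x := Quotient.exact hyx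
    rw [mem_orbitDimFiltration] at hy ⊢
    rwa [← orbitDim_smul m t x]
  · exact fun h => ⟨x, h, rfl⟩

end OrbitFiltration

/-- Concatenation of coordinates. -/
def euclideanAppend (l i : ℕ) :
    EuclideanSpace ℝ (Fin l) × (Fin i → ℝ) ≃ₜ EuclideanSpace ℝ (Fin (l + i)) :=
  ((EuclideanSpace.equiv (Fin l) ℝ).toHomeomorph.prodCongr (Homeomorph.refl _)).trans
    ((Fin.appendHomeomorph l i).trans (EuclideanSpace.equiv (Fin (l + i)) ℝ).symm.toHomeomorph)

namespace StandardChart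

variable {l m n i : ℕ} {X : Type u} [TopologicalSpace X] [MulAction (Torus m) X] {x : X}
  {L : Type u} [TopologicalSpace L] [MulAction (Torus (n - i)) L]

theorem mem_stabilizer_iff_cone (c : StandardChart l m n i x L) (y : c.U) (t : Torus m) :
    t ∈ MulAction.stabilizer (Torus m) (y : X) ↔
      (c.ψ t).1 = 1 ∧ Cone.map (fun v => (c.ψ t).2 • v) (c.φ y).2.2 = (c.φ y).2.2 := by
  have h := c.equivariant t y
  rw [MulAction.mem_stabilizer_iff]
  have h1 : t • (y : X) = y ↔ c.φ ⟨t • (y : X), c.smul_mem_U t y y.2⟩ = c.φ y := by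
    rw [c.φ.injective.eq_iff, Subtype.ext_iff]
  rw [h1, h]
  constructor
  · intro h2
    have h3 := congrArg (fun z => z.2.1) h2
    have h4 := congrArg (fun z => z.2.2) h2
    refine ⟨Prod.ext ?_ ?_, h4⟩
    · funext a
      have h5 := congrFun (congrArg (fun z => (z.1 : Fin i → ℂ)) h3) a
      have h6 := c.ne_zero_of_mem_Ω _ (c.φ y).2.1.1.2 a
      exact Circle.ext (by simpa [h6] using h5)
    · have h5 := congrArg (fun z => z.2) h3
      simpa using h5
  · rintro ⟨h2, h3⟩
    rw [h3]
    refine Prod.ext rfl (Prod.ext (Prod.ext (Subtype.ext ?_) ?_) rfl)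
    · funext a
      simp [h2]
    · simp [h2]

theorem orbitDim_of_apex (c : StandardChart l m n i x L) (hi : i ≤ n) (hn : n ≤ m) {y : c.U}
    (h : (c.φ y).2.2 = Cone.apex L) : orbitDim m (y : X) = i + (m - n) := by
  rw [orbitDim, subgroupDim_eq_of_prod c.ψ (H' := ⊤), subgroupDim_top]
  · omega
  · intro t
    rw [mem_stabilizer_iff_cone, h]
    simp

theorem orbitDim_of_mk (c : StandardChart l m n i x L) (hi : i ≤ n) (hn : n ≤ m) {y : c.U}
    {v : L} {s : Set.Ico (0 : ℝ) 1} (hs : (s : ℝ) ≠ 0) (h : (c.φ y).2.2 = Cone.mk v s) :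
    orbitDim m (y : X) = i + (m - n) + orbitDim (n - i) v := by
  rw [orbitDim, subgroupDim_eq_of_prod c.ψ (H' := MulAction.stabilizer _ v), orbitDim]
  -- The bound makes the truncated subtraction in `orbitDim` a true one.
  · have := subgroupDim_le (MulAction.stabilizer (Torus (n - i)) v)
    omega
  · intro t
    rw [mem_stabilizer_iff_cone, h, MulAction.mem_stabilizer_iff, Cone.map_mk]
    refine and_congr_right fun _ => ⟨fun h => (Cone.mk_inj hs h).1, fun h => by rw [h]⟩

/-- The map from the domain of a standard chart whose fibres are the orbits. -/
def orbitMap (c : StandardChart l m n i x L) (y : c.U) :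
    EuclideanSpace ℝ (Fin (l + i)) × Cone (OrbitSpace (n - i) L) :=
  (euclideanAppend l i ((c.φ y).1, fun a => ‖(c.φ y).2.1.1.1 a‖),
    Cone.map (Quotient.mk (MulAction.orbitRel (Torus (n - i)) L)) (c.φ y).2.2)

/-- The range of `orbitMap` is thus a product with the whole cone, so only the Euclidean factor has
to be shrunk later. -/
theorem exists_orbitMap_eq (c : StandardChart l m n i x L) (y : c.U)
    (z : Cone (OrbitSpace (n - i) L)) : ∃ y' : c.U, c.orbitMap y' = ((c.orbitMap y).1, z) := by
  obtain ⟨z, rfl⟩ := Cone.map_surjective Quotient.mk_surjective z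
  exact ⟨c.φ.symm ((c.φ y).1, (c.φ y).2.1, z), by simp [orbitMap]⟩

theorem orbitMap_eq_iff (c : StandardChart l m n i x L) (y y' : c.U) :
    Quotient.mk (MulAction.orbitRel (Torus m) X) y =
      Quotient.mk (MulAction.orbitRel (Torus m) X) y' ↔ c.orbitMap y = c.orbitMap y' := by
  constructor
  · intro h
    obtain ⟨t, ht⟩ : (y : X) ∈ MulAction.orbit (Torus m) (y' : X) := Quotient.exact h
    have hy : y = ⟨t • (y' : X), c.smul_mem_U t y' y'.2⟩ := Subtype.ext ht.symm
    have hφ := c.equivariant t y'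
    rw [← hy] at hφ
    rw [orbitMap, orbitMap, hφ]
    refine Prod.ext ?_ ?_
    · simp only [Complex.norm_mul, Circle.norm_coe, one_mul]
    · exact (Cone.map_mk_eq_iff _ _).2 ⟨_, rfl⟩
  · intro h
    obtain ⟨h1, h2⟩ := Prod.ext_iff.1 h
    obtain ⟨h3, h4⟩ := Prod.ext_iff.1 ((euclideanAppend l i).injective h1)
    obtain ⟨t₃, ht₃⟩ := (Cone.map_mk_eq_iff _ _).1 h2
    choose t₁ ht₁ using fun a => exists_circle_mul_eq
      (c.ne_zero_of_mem_Ω _ (c.φ y').2.1.1.2 a) (congrFun h4 a)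
    -- The element carrying `y'` to `y` is assembled factor by factor: phases on `Ω`, a quotient in
    -- `U(1)^(m-n)`, and `t₃` on the cone.
    let t : Torus m := c.ψ.symm ((t₁, (c.φ y).2.1.2 * ((c.φ y').2.1.2)⁻¹), t₃)
    have ht : c.ψ t = ((t₁, (c.φ y).2.1.2 * ((c.φ y').2.1.2)⁻¹), t₃) := c.ψ.apply_symm_apply _
    refine Quotient.sound ⟨t, ?_⟩
    have key : c.φ ⟨t • (y' : X), c.smul_mem_U t y' y'.2⟩ = c.φ y := by
      rw [c.equivariant]
      refine Prod.ext (Subtype.ext h3.symm) (Prod.ext (Prod.ext (Subtype.ext ?_) ?_) ?_)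
      · funext a
        simpa [ht] using ht₁ a
      · simp [ht]
      · simpa [ht] using ht₃
    exact congrArg Subtype.val (c.φ.injective key)

theorem continuous_orbitMap (c : StandardChart l m n i x L) : Continuous c.orbitMap := by
  have h := c.φ.continuous
  refine Continuous.prodMk ((euclideanAppend l i).continuous.comp (by
    have h1 : Continuous fun y => (c.φ y).2.1.1.1 := by fun_prop
    exact Continuous.prodMk (by fun_prop)
      (continuous_pi fun a => ((continuous_apply a).comp h1).norm)))
    ((Cone.continuous_map continuous_quotient_mk').comp (by fun_prop))

theorem isOpenMap_orbitMap [ContinuousConstSMul (Torus (n - i)) L]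
    (c : StandardChart l m n i x L) : IsOpenMap c.orbitMap := by
  have h1 : IsOpenMap fun z : c.Ω × Torus (m - n) => fun a => ‖z.1.1 a‖ :=
    (isOpenMap_norm_restrict c.isOpen_Ω c.ne_zero_of_mem_Ω).comp isOpenMap_fst
  have h2 : IsOpenMap (Cone.map (Quotient.mk (MulAction.orbitRel (Torus (n - i)) L))) :=
    Cone.isOpenMap_map isOpenMap_quotient_mk'_mul Quotient.mk_surjective
  have h3 : IsOpenMap fun z : c.O × (c.Ω × Torus (m - n)) × Cone L =>
      (((z.1 : EuclideanSpace ℝ (Fin l)), fun a => ‖z.2.1.1.1 a‖),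
        Cone.map (Quotient.mk (MulAction.orbitRel (Torus (n - i)) L)) z.2.2) :=
    ((c.isOpen_O.isOpenMap_subtype_val.prodMap h1).prodMap h2).comp
      (Homeomorph.prodAssoc _ _ _).symm.isOpenMap
  exact (((euclideanAppend l i).isOpenMap.prodMap IsOpenMap.id).comp h3).comp c.φ.isOpenMap

/-- The vertex has the least orbit dimension in the chart, `i + (m-n)`. This yields the final
clause, which is what identifies the stratum with `F (l + i)` inside the chart. -/
theorem exists_coneChart [ContinuousConstSMul (Torus m) X]
    [ContinuousConstSMul (Torus (n - i)) L]
    (c : StandardChart l m n i x L) (hi : i ≤ n) (hn : n ≤ m)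
    {G : ℤ → Set (OrbitSpace (n - i) L)}
    (hG : ∀ (j : ℤ) (v : L), Quotient.mk (MulAction.orbitRel (Torus (n - i)) L) v ∈ G j ↔
      (orbitDim (n - i) v : ℤ) ≤ j + 1) :
    ∃ C : ConeChart (orbitSpaceFiltration l m n X) (l + i) ((n : ℤ) - i - 1)
        (Quotient.mk (MulAction.orbitRel (Torus m) X) x) (OrbitSpace (n - i) L) G,
      ∀ q ∈ C.U, q ∉ orbitSpaceFiltration l m n X ((l : ℤ) + i - 1) := by
  have hπ : IsOpenQuotientMap (Quotient.mk (MulAction.orbitRel (Torus m) X)) :=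
    MulAction.isOpenQuotientMap_quotientMk
  obtain ⟨ε, hε, hB⟩ := Metric.isOpen_iff.1
    (isOpenMap_fst.comp c.isOpenMap_orbitMap).isOpen_range (c.orbitMap ⟨x, c.mem_U⟩).1
    ⟨⟨x, c.mem_U⟩, rfl⟩
  -- The moduli of `Ω` need not form a contractible set, so the Euclidean factor is cut down to a
  -- ball.
  let B := Metric.ball (c.orbitMap ⟨x, c.mem_U⟩).1 ε
  have hW : B ×ˢ Set.univ ⊆ Set.range c.orbitMap := by
    rintro ⟨b, z⟩ ⟨hb, -⟩
    obtain ⟨y, rfl⟩ := hB hb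
    exact c.exists_orbitMap_eq y z
  obtain ⟨U', hU', hmem, e, he⟩ := exists_homeomorph_image hπ c.isOpen_U c.continuous_orbitMap
    c.isOpenMap_orbitMap c.orbitMap_eq_iff (Metric.isOpen_ball.prod isOpen_univ) hW
  let φ : U' ≃ₜ B × Cone (OrbitSpace (n - i) L) :=
    e.trans ((Homeomorph.Set.prod _ _).trans
      ((Homeomorph.refl _).prodCongr (Homeomorph.Set.univ _)))
  have hφ : ∀ (y : c.U) (hy : Quotient.mk _ (y : X) ∈ U'),
      (φ ⟨Quotient.mk _ (y : X), hy⟩).2 = (c.orbitMap y).2 := fun y hy => by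
    rw [← he y hy]; rfl
  refine ⟨⟨U', hU', (hmem _).2 ⟨⟨x, c.mem_U⟩, ⟨Metric.mem_ball_self hε, trivial⟩, rfl⟩, B,
    Metric.isOpen_ball,
    (convex_ball _ _).contractibleSpace ⟨_, Metric.mem_ball_self hε⟩, φ, ?_⟩, ?_⟩
  · rintro j hj - ⟨q, hq⟩
    obtain ⟨y, -, rfl⟩ := (hmem q).1 hq
    rw [hφ y hq, mk_mem_orbitSpaceFiltration, orbitMap]
    rcases (c.φ y).2.2.exists_rep with h | ⟨v, s, hs, h⟩
    · rw [c.orbitDim_of_apex hi hn h, h, Cone.map_apex]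
      -- The inequality on orbit dimensions reduces to `-1 ≤ j`.
      refine iff_of_true ?_ (Or.inl rfl)
      push_cast [hn]
      linarith
    · rw [c.orbitDim_of_mk hi hn hs h, h, Cone.map_mk, Cone.mk_mem_subcone hs, hG]
      push_cast [hn]
      constructor <;> intro <;> linarith
  · intro q hq
    obtain ⟨y, -, rfl⟩ := (hmem q).1 hq
    rw [mk_mem_orbitSpaceFiltration]
    rcases (c.φ y).2.2.exists_rep with h | ⟨v, s, hs, h⟩
    · rw [c.orbitDim_of_apex hi hn h]
      push_cast [hn]
      linarith
    · rw [c.orbitDim_of_mk hi hn hs h]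
      push_cast [hn]
      linarith

end StandardChart

/-! ### Strata of cone charts -/

theorem nonempty_chartedSpace_of_isOpenEmbedding {H Y : Type*} [TopologicalSpace H]
    [TopologicalSpace Y]
    (h : ∀ p : Y, ∃ V : Set Y, IsOpen V ∧ p ∈ V ∧ ∃ f : V → H, IsOpenEmbedding f) :
    Nonempty (ChartedSpace H Y) := by
  have h' : ∀ p : Y, ∃ e : OpenPartialHomeomorph Y H, p ∈ e.source := by
    intro p
    obtain ⟨V, hV, hp, f, hf⟩ := h p
    have : Nonempty V := ⟨⟨p, hp⟩⟩
    refine ⟨hV.isOpenEmbedding_subtypeVal.toOpenPartialHomeomorph.symm.trans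
      hf.toOpenPartialHomeomorph, ?_⟩
    simpa using hp
  choose e he using h'
  exact ⟨⟨Set.range e, e, he, fun p => ⟨p, rfl⟩⟩⟩

theorem isTopManifold_connectedComponentIn {Q : Type u} [TopologicalSpace Q] [T2Space Q]
    [SecondCountableTopology Q] {d : ℕ} {S : Set Q}
    (h : Nonempty (ChartedSpace (EuclideanSpace ℝ (Fin d)) S)) {x : Q} (hx : x ∈ S) :
    IsTopManifold d (connectedComponentIn S x) := by
  obtain ⟨hS⟩ := h
  refine ⟨inferInstance, inferInstance, ?_⟩
  -- Local connectedness makes components open in `S`, so they inherit its charts.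
  have := ChartedSpace.locallyConnectedSpace (EuclideanSpace ℝ (Fin d)) S
  have hsub : connectedComponentIn S x ⊆ S := connectedComponentIn_subset S x
  have ho : IsOpenEmbedding (Set.inclusion hsub) := by
    refine ⟨.inclusion hsub, ?_⟩
    have : Set.range (Set.inclusion hsub) = connectedComponent (⟨x, hx⟩ : S) := by
      rw [Set.range_inclusion]
      ext s
      rw [Set.mem_ofPred_eq, connectedComponentIn_eq_image hx]
      simp
    rw [this]
    exact isOpen_connectedComponent
  have : Nonempty (connectedComponentIn S x) := ⟨⟨x, mem_connectedComponentIn hx⟩⟩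
  have := ho.singletonChartedSpace
  exact ⟨ChartedSpace.comp _ S _⟩

/-- The case `j = -1` of the chart condition: as `G (-1)` is empty, its subcone is the vertex alone,
and `S` is locally `O × {vertex}`. -/
theorem ConeChart.exists_isOpenEmbedding {Q : Type u} [TopologicalSpace Q] {F : ℤ → Set Q}
    {k : ℕ} {r : ℤ} {p : Q} {L : Type u} [TopologicalSpace L] {G : ℤ → Set L}
    (C : ConeChart F k r p L G) (hr : -1 ≤ r) (hG : G (-1) = ∅) {S : Set Q} (hp : p ∈ S)
    (hS : ∀ q ∈ C.U, q ∈ S ↔ q ∈ F k) :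
    ∃ V : Set S, IsOpen V ∧ ⟨p, hp⟩ ∈ V ∧ ∃ f : V → EuclideanSpace ℝ (Fin k),
      IsOpenEmbedding f := by
  have key : ∀ u : C.U, (u : Q) ∈ S ↔ (C.φ u).2 = Cone.apex L := fun u => by
    have := C.map_filtration (-1) le_rfl hr u
    rw [hS u u.2]
    simpa [hG, subcone] using this
  let V : Set S := {s | (s : Q) ∈ C.U}
  let e : V ≃ₜ C.O :=
    { toFun := fun s => (C.φ ⟨s, s.2⟩).1
      invFun := fun o => ⟨⟨C.φ.symm (o, Cone.apex L), (key _).2 (by simp)⟩, (C.φ.symm _).2⟩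
      left_inv := fun s => by
        have h1 := (key ⟨s, s.2⟩).1 s.1.2
        refine Subtype.ext (Subtype.ext ?_)
        change (C.φ.symm ((C.φ ⟨s, s.2⟩).1, Cone.apex L) : Q) = s
        rw [← h1, Prod.mk.eta, C.φ.symm_apply_apply]
      right_inv := fun o => by simp
      continuous_toFun := by
        have := C.φ.continuous
        fun_prop
      continuous_invFun := by
        have := C.φ.symm.continuous
        fun_prop }
  exact ⟨V, C.isOpen_U.preimage continuous_subtype_val, C.mem_U, _,
    C.isOpen_O.isOpenEmbedding_subtypeVal.comp e.isOpenEmbedding⟩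

/-! ### Orbit spaces of locally standard torus pseudomanifolds -/

namespace IsAdmissible

variable {l m n : ℕ} {X : Type u} [TopologicalSpace X] [MulAction (Torus m) X]

theorem compactSpace_orbitSpace (h : IsAdmissible l m n X) : CompactSpace (OrbitSpace m X) := by
  have := h.compact
  exact Quotient.compactSpace

theorem t2Space_orbitSpace (h : IsAdmissible l m n X) : T2Space (OrbitSpace m X) := by
  have := h.compact
  have := h.t2
  have := h.continuous_smul
  -- A continuous map from a compact space to a Hausdorff space is proper.
  have : ProperSMul (Torus m) X := ⟨Continuous.isProperMap (by fun_prop)⟩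
  exact t2Space_quotient_mulAction_of_properSMul

theorem secondCountableTopology_orbitSpace (h : IsAdmissible l m n X) :
    SecondCountableTopology (OrbitSpace m X) := by
  have := h.secondCountable
  have := h.continuous_smul
  exact ContinuousConstSMul.secondCountableTopology

theorem le_orbitDim (h : IsAdmissible l m n X) (x : X) : m - n ≤ orbitDim m x := by
  have hx : x ∉ {x : X | (orbitDim m x : ℤ) ≤ (m - n) - 1} := by
    rw [h.no_small_orbits]
    exact Set.notMem_empty x
  rw [Set.mem_ofPred_eq] at hx
  omega

theorem isFiltration_orbitSpaceFiltration (h : IsAdmissible l m n X) :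
    IsFiltration (l : ℤ) ((l : ℤ) + n) (orbitSpaceFiltration l m n X) where
  mono := fun j k hjk => Set.image_mono (h.stratified.filtration.mono (by omega))
  closed := fun j => by
    have := h.continuous_smul
    have hπ : IsOpenQuotientMap (Quotient.mk (MulAction.orbitRel (Torus m) X)) :=
      MulAction.isOpenQuotientMap_quotientMk
    rw [← hπ.isQuotientMap.isClosed_preimage]
    convert h.stratified.filtration.closed ((l : ℤ) + 2 * (j - l) + (m - n)) using 1
    ext x
    rw [Set.mem_preimage, mk_mem_orbitSpaceFiltration, mem_orbitDimFiltration]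
  top := by
    refine Set.eq_univ_of_forall fun q => ?_
    obtain ⟨x, rfl⟩ := Quotient.exists_rep q
    rw [mk_mem_orbitSpaceFiltration]
    have := orbitDim_le m x
    omega
  bot := by
    refine Set.eq_empty_of_forall_notMem fun q hq => ?_
    obtain ⟨x, rfl⟩ := Quotient.exists_rep q
    rw [mk_mem_orbitSpaceFiltration] at hq
    have := h.le_orbitDim x
    have := h.le
    omega

end IsAdmissible

/-- The orbits are exactly the fibres of the projection to the discrete factor, hence open. -/
theorem discreteTopology_orbitSpace {m : ℕ} {X D : Type*} [TopologicalSpace X]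
    [MulAction (Torus m) X] [TopologicalSpace D] [DiscreteTopology D] (e : X ≃ₜ D × Torus m)
    (he : ∀ (t : Torus m) (x : X), e (t • x) = ((e x).1, t * (e x).2)) :
    DiscreteTopology (OrbitSpace m X) := by
  rw [discreteTopology_iff_isOpen_singleton]
  intro q
  obtain ⟨x, rfl⟩ := Quotient.exists_rep q
  have : Quotient.mk (MulAction.orbitRel (Torus m) X) ⁻¹' {Quotient.mk _ x} =
      (fun y => (e y).1) ⁻¹' {(e x).1} := by
    ext y
    constructor
    · intro h
      obtain ⟨t, rfl⟩ : y ∈ MulAction.orbit (Torus m) x := Quotient.exact h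
      exact (congrArg Prod.fst (he t x) :)
    · intro h
      refine Quotient.sound ⟨(e y).2 * ((e x).2)⁻¹, e.injective ?_⟩
      change e (((e y).2 * ((e x).2)⁻¹) • x) = e y
      rw [he]
      exact Prod.ext (Eq.symm h) (by simp)
  rw [← isQuotientMap_quotient_mk'.isOpen_preimage]
  change IsOpen (Quotient.mk (MulAction.orbitRel (Torus m) X) ⁻¹' {Quotient.mk _ x})
  rw [this]
  exact (isOpen_discrete _).preimage (continuous_fst.comp e.continuous)

theorem IsLocallyStandardTPseudomanifold.isStratifiedPseudomanifold (l m n : ℕ) (X : Type u)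
    [TopologicalSpace X] [MulAction (Torus m) X] (hX : IsLocallyStandardTPseudomanifold l m n X) :
    IsStratifiedPseudomanifold l n (OrbitSpace m X) (orbitSpaceFiltration l m n X) := by
  rw [IsLocallyStandardTPseudomanifold] at hX
  obtain ⟨hA, h0, h1⟩ := hX
  have hT2 := hA.t2Space_orbitSpace
  have hSC := hA.secondCountableTopology_orbitSpace
  have hsm := hA.continuous_smul
  have hnm := hA.le
  rw [IsStratifiedPseudomanifold]
  refine ⟨hT2, hA.isFiltration_orbitSpaceFiltration, ?_, ?_⟩
  · intro hln
    obtain ⟨k, e, he⟩ := h0 hln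
    exact discreteTopology_orbitSpace e he
  intro hln
  obtain ⟨hdense, hchart⟩ := h1 hln
  -- Besides the link condition, this keeps `G (-1) = ∅` and the avoidance of lower strata, both
  -- needed for the manifold condition.
  have hlink : ∀ i : ℕ, i ≤ n →
      ∀ p ∈ orbitSpaceFiltration l m n X ((l : ℤ) + i) \
        orbitSpaceFiltration l m n X ((l : ℤ) + i - 1),
      ∃ (L : Type u) (_ : TopologicalSpace L) (G : ℤ → Set L),
        CompactSpace L ∧ (IsEmpty L ∨ ∃ (l' n' : ℕ) (_ : l' + n' + i + 1 = n),
          IsStratifiedPseudomanifold l' n' L G) ∧ G (-1) = ∅ ∧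
        ∃ C : ConeChart (orbitSpaceFiltration l m n X) (l + i) ((n : ℤ) - i - 1) p L G,
          ∀ q ∈ C.U, q ∉ orbitSpaceFiltration l m n X ((l : ℤ) + i - 1) := by
    intro i hi p hp
    obtain ⟨x, rfl⟩ := Quotient.exists_rep p
    obtain ⟨L, _, _, hL, ⟨c⟩⟩ := hchart i hi x (by
      have e1 : (l : ℤ) + 2 * i = l + 2 * (((l : ℤ) + i) - l) := by ring
      have e2 : (l : ℤ) + 2 * ((i : ℤ) - 1) = l + 2 * (((l : ℤ) + i - 1) - l) := by ring
      rw [e1, e2, Set.mem_sdiff, mem_orbitDimFiltration, mem_orbitDimFiltration,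
        ← mk_mem_orbitSpaceFiltration, ← mk_mem_orbitSpaceFiltration]
      exact hp)
    rcases hL with hL | ⟨l', n', hln', hL⟩
    · have : ContinuousConstSMul (Torus (n - i)) L :=
        ⟨fun _ => continuous_of_const fun v => hL.elim v⟩
      have : IsEmpty (OrbitSpace (n - i) L) := ⟨fun q => hL.elim q.out⟩
      -- For an empty link the cone is a point, and every subcone is the vertex.
      exact ⟨OrbitSpace (n - i) L, inferInstance, fun _ => ∅, inferInstance, Or.inl inferInstance,
        rfl, c.exists_coneChart hi hnm fun j v => hL.elim v⟩
    · have ih := IsLocallyStandardTPseudomanifold.isStratifiedPseudomanifold l' (n - i) n' L hL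
      rw [IsLocallyStandardTPseudomanifold] at hL
      have hAL := hL.1
      have := hAL.continuous_smul
      have hG : ∀ (j : ℤ) (v : L), Quotient.mk (MulAction.orbitRel (Torus (n - i)) L) v ∈
          orbitSpaceFiltration l' (n - i) n' L j ↔ (orbitDim (n - i) v : ℤ) ≤ j + 1 := by
        intro j v
        rw [mk_mem_orbitSpaceFiltration]
        -- `l' + n' + i + 1 = n` gives `(j - l') + ((n - i) - n') = j + 1`.
        omega
      refine ⟨OrbitSpace (n - i) L, inferInstance, orbitSpaceFiltration l' (n - i) n' L,
        hAL.compactSpace_orbitSpace, Or.inr ⟨l', n', hln', ih⟩, ?_, c.exists_coneChart hi hnm hG⟩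
      refine Set.eq_empty_of_forall_notMem fun q hq => ?_
      obtain ⟨v, rfl⟩ := Quotient.exists_rep q
      -- Orbits in the link have dimension at least `(n - i) - n' = l' + 1 > 0`, whereas membership
      -- in `G (-1)` would force dimension `0`.
      have h2 := hAL.le_orbitDim v
      rw [hG] at hq
      omega
  refine ⟨?_, ?_, ?_, ?_, ?_⟩
  · intro h
    -- Rounding down, `X_{l+m+n-1}` is also the set where the orbit dimension is at most `m - 1`.
    refine hA.stratified.top_strict (Set.eq_univ_of_forall fun x => ?_)
    have hx := h.symm ▸ Set.mem_univ (Quotient.mk (MulAction.orbitRel (Torus m) X) x)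
    rw [mk_mem_orbitSpaceFiltration] at hx
    rw [orbitDimFiltration, Set.mem_ofPred_eq]
    push_cast
    omega
  · obtain ⟨x, hx⟩ := hA.stratified.low_nonempty
    refine ⟨Quotient.mk _ x, ?_⟩
    rw [mk_mem_orbitSpaceFiltration]
    rw [orbitDimFiltration, Set.mem_ofPred_eq] at hx
    push_cast [hnm] at hx
    omega
  · intro i hi x hx
    refine isTopManifold_connectedComponentIn
      (nonempty_chartedSpace_of_isOpenEmbedding fun p => ?_) hx
    obtain ⟨L, _, G, -, -, hG, C, hC⟩ := hlink i hi p p.2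
    refine C.exists_isOpenEmbedding (by omega) hG p.2 fun q hq => ?_
    rw [Nat.cast_add]
    exact ⟨fun h => h.1, fun h => ⟨h, hC q hq⟩⟩
  -- A continuous surjection preserves density, and points outside `X_{l+m+n-2}` have orbit
  -- dimension `m`, so they map to the top stratum.
  · refine (Quotient.mk_surjective.denseRange.dense_image continuous_quotient_mk' hdense).mono ?_
    rintro _ ⟨x, ⟨-, hx⟩, rfl⟩
    rw [Set.mem_sdiff, mk_mem_orbitSpaceFiltration, mk_mem_orbitSpaceFiltration]
    rw [orbitDimFiltration, Set.mem_ofPred_eq] at hx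
    have := orbitDim_le m x
    omega
  · intro i hi p hp
    obtain ⟨L, hLt, G, hLc, hL, -, C, -⟩ := hlink i hi p hp
    exact ⟨L, hLt, G, hLc, hL, ⟨C⟩⟩
termination_by l + n

end TPseudo

end

theorem mainTheorem7 (l m n : ℕ) (X : Type u) [TopologicalSpace X]
    [MulAction (TPseudo.Torus m) X]
    (hX : TPseudo.IsLocallyStandardTPseudomanifold l m n X) :
    CompactSpace (TPseudo.OrbitSpace m X) ∧
    T2Space (TPseudo.OrbitSpace m X) ∧
    SecondCountableTopology (TPseudo.OrbitSpace m X) ∧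
    TPseudo.IsStratifiedPseudomanifold l n (TPseudo.OrbitSpace m X)
      (TPseudo.orbitSpaceFiltration l m n X) := by
  have hA : TPseudo.IsAdmissible l m n X := by
    rw [TPseudo.IsLocallyStandardTPseudomanifold] at hX
    exact hX.1
  exact ⟨hA.compactSpace_orbitSpace, hA.t2Space_orbitSpace,
    hA.secondCountableTopology_orbitSpace, hX.isStratifiedPseudomanifold⟩
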